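/- Let $V$ be a finite set of variables. A partition of $V$ is a finite family $P=\{V_1,\dots,V_n\}$ of pairwise disjoint (possibly empty) subsets of $V$ with $V_1\cup\dots\cup V_n=V$. A semilinear representation over $V$ is a finite list of pairs, each consisting of a base vector $b\in\mathbb N^V$ and a finite list of period vectors $p_1,\dots,p_m\in\mathbb N^V$; it denotes the union of the sets $\{b+\lambda_1p_1+\dots+\lambda_mp_m \mid \lambda_1,\dots,\lambda_m\in\mathbb N\}$, and the sets so denoted are the semilinear sets. A set $S\subseteq\mathbb N^V$ is $P$-compatible if it has a semilinear representation in which each period vector vanishes outside $V_i$ for some $i\in[1,n]$ (which may depend on the period). **Theorem 5.3.** (1) Given a finite set $V$, a partition $P$ of $V$ and a semilinear set $S\subseteq\mathbb N^V$, it is decidable whether $S$ is $P$-compatible: there is one computable function which, for all $d,n\in\mathbb N$, on input $d$, the list of the parts of a partition $P=\{V_1,\dots,V_n\}$ of $V=\{0,\dots,d-1\}$ and a semilinear representation of $S\subseteq\mathbb N^V$, decides whether $S$ is $P$-compatible. (2) Let $P=\{V_1,\dots,V_n\}$ be a partition of a finite set $V$ and let $S\subseteq\mathbb N^V$ be semilinear.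 For $\gamma\in\mathbb N^V$ and $\alpha\in\mathbb N^{V_i}$ let $\gamma[i/\alpha]\in\mathbb N^V$ be the vector that agrees with $\alpha$ on $V_i$ and with $\gamma$ elsewhere. For $\alpha,\beta\in\mathbb N^{V_i}$ write $\alpha\sim_i\beta$ if for every $\gamma\in\mathbb N^V$ we have $\gamma[i/\alpha]\in S$ if and only if $\gamma[i/\beta]\in S$. Then $S$ is $P$-compatible if and only if each of the equivalence relations $\sim_1,\dots,\sim_n$ has finite index; equivalently, if and only if there is $k\in\mathbb N$ such that for every $i\in[1,n]$ and $\alpha\in\mathbb N^{V_i}$ there is $\beta\in\mathbb N^{V_i}$ with $\sum_{v\in V_i}\beta(v)\le k$ and $\alpha\sim_i\beta$. Moreover, for each $i$ the relation $\sim_i$ is definable in Presburger arithmetic $(\mathbb N;0,1,+)$ as a subset of $\mathbb N^{V_i}\times\mathbb N^{V_i}$. (3) If, in the situation of (2), every $V_i$ is a singleton, then $S$ is $P$-compatible if and only if $S$ is recognizable, i.e. $S=\varphi^{-1}(\varphi(S))$ for some morphism $\varphi$ from the monoid $\mathbb N^V$ to a finite monoid. -/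

import Mathlib

namespace PCompat

open Pointwise

/-- A semilinear representation over the variables `V`: a finite list of linear components, each
given by its base vector and the finite list of its period vectors. -/
abbrev SemilinearRep (V : Type*) := List ((V → ℕ) × List (V → ℕ))

/-- The semilinear set denoted by a representation: the union over the components `(b, ps)` of
`b + ⟨ps⟩`, where `⟨ps⟩` is the set of all sums of vectors in `ps` (with repetitions). -/
def SemilinearRep.toSet {V : Type*} (R : SemilinearRep V) : Set (V → ℕ) :=
  ⋃ c ∈ R, c.1 +ᵥ (AddSubmonoid.closure {p | p ∈ c.2} : Set (V → ℕ))

/-- The sets with a semilinear representation are exactly Mathlib's semilinear sets. -/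
theorem isSemilinearSet_iff_exists_rep {V : Type*} {S : Set (V → ℕ)} :
    IsSemilinearSet S ↔ ∃ R : SemilinearRep V, R.toSet = S := by
  constructor
  · rintro ⟨T, hT, hlin, rfl⟩
    induction T, hT using Set.Finite.induction_on with
    | empty => exact ⟨[], by simp [SemilinearRep.toSet]⟩
    | @insert s T _ _ ih =>
      obtain ⟨R, hR⟩ := ih fun t ht => hlin t (Set.mem_insert_of_mem _ ht)
      obtain ⟨b, t, ht, hs⟩ := hlin s (Set.mem_insert _ _)
      refine ⟨(b, ht.toFinset.toList) :: R, ?_⟩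
      rw [Set.sUnion_insert, ← hR, hs]
      simp [SemilinearRep.toSet]
  · rintro ⟨R, rfl⟩
    refine ⟨(fun c : (V → ℕ) × List (V → ℕ) =>
      c.1 +ᵥ (AddSubmonoid.closure {p | p ∈ c.2} : Set (V → ℕ))) '' {c | c ∈ R},
      (List.finite_toSet R).image _, ?_, ?_⟩
    · rintro _ ⟨c, _, rfl⟩
      exact ⟨c.1, _, List.finite_toSet c.2, rfl⟩
    · simp [SemilinearRep.toSet, Set.sUnion_image]

/-- `P = {V₁, …, Vₙ}` is a partition of `V`: the parts are pairwise disjoint and cover `V`.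
Parts may be empty. -/
def IsPartition {V : Type*} {n : ℕ} (P : Fin n → Finset V) : Prop :=
  (∀ i j, i ≠ j → Disjoint (P i) (P j)) ∧ ∀ v, ∃ i, v ∈ P i

/-- `S` is `P`-compatible: it has a semilinear representation in which every period vector belongs
to `ℕ^{Vᵢ}` for some `i`, that is, vanishes outside `Vᵢ`. -/
def IsCompatible {V : Type*} {n : ℕ} (P : Fin n → Finset V) (S : Set (V → ℕ)) : Prop :=
  ∃ R : SemilinearRep V,
    (∀ c ∈ R, ∀ p ∈ c.2, ∃ i, ∀ v, v ∉ P i → p v = 0) ∧ R.toSet = S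

/-- The vector `γ[U/α]`, which agrees with `α` on `U` and with `γ` elsewhere. -/
def replaceOn {V : Type*} [DecidableEq V] (U : Finset V) (γ : V → ℕ) (α : U → ℕ) : V → ℕ :=
  fun v => if h : v ∈ U then α ⟨v, h⟩ else γ v

/-- The equivalence relation on `ℕ^U` given by `α ∼ β` iff for every `γ ∈ ℕ^V`,
`γ[U/α] ∈ S` if and only if `γ[U/β] ∈ S`. -/
def exchangeSetoid {V : Type*} [DecidableEq V] (S : Set (V → ℕ)) (U : Finset V) :
    Setoid (U → ℕ) where
  r α β := ∀ γ : V → ℕ, replaceOn U γ α ∈ S ↔ replaceOn U γ β ∈ S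
  iseqv := ⟨fun _ _ => Iff.rfl, fun h γ => (h γ).symm, fun h₁ h₂ γ => (h₁ γ).trans (h₂ γ)⟩

/-- `S` is a recognizable subset of the (additive) monoid `M`: `S = φ⁻¹(φ(S))` for some morphism
`φ` from `M` to a finite monoid. -/
def IsRecognizable {M : Type*} [AddMonoid M] (S : Set M) : Prop :=
  ∃ (F : Type) (_ : AddMonoid F) (_ : Finite F) (φ : M →+ F), S = φ ⁻¹' (φ '' S)

/-- Inputs of the decision problem: the number of variables, the list of the parts of the
partition (each a list of variable indices), and a list of linear components (base vector, list of
period vectors), where a vector is the list of its coordinates. -/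
abbrev Input := ℕ × List (List ℕ) × List (List ℕ × List (List ℕ))

/-- The input that presents a partition `P` of `{0, …, d-1}` and a semilinear representation. -/
def code {d n : ℕ} (P : Fin n → Finset (Fin d)) (R : SemilinearRep (Fin d)) : Input :=
  (d, List.ofFn fun i => ((P i).sort (· ≤ ·)).map Fin.val,
    R.map fun c => (List.ofFn c.1, c.2.map List.ofFn))

end PCompat

/-! Compatibility is finiteness of all exchange relations. If every period lies in one part, each
period is either supported on `P i` or zero on it. Membership of `γ[U/α]` in a linear component,
with `U = P i`, then splits into a condition on `α` and one on `γ` (`replaceOn_mem_linear_iff`), and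
the class of `α` is determined by the components whose condition it meets. Conversely, `S` is a
union of products of classes (`mem_iff_of_exchange`). If there are finitely many, this is a finite
union of sums of sets supported on single parts; the classes are semilinear because the relations
are Presburger definable, so these sums are compatible.

For decidability, finite index is written as `∃ k, ∀ α, ∃ β < k, ∀ γ, …`. Vectors are read as words
of binary digit vectors, least significant digit first, so a set with finitely many residuals is one
recognized by a finite automaton. Semilinear sets have an explicit number of residuals
(`SemilinearRep.hasResiduals`), Boolean operations and quantifiers change this number in a
controlled way, and a nonempty set with `N` residuals has an element below `2 ^ N`. Hence all
quantifiers can be bounded by explicit towers of exponentials (`finite_quotient_iff_bounded`), and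
the bounded statement is primitive recursive (`primrecPred_compatTest`).

For singleton parts, every class is an ultimately periodic set of numbers. A common threshold and
period give a finite quotient of `ℕ`, whose power recognizes `S`. -/

namespace PCompat

open Pointwise

/-! ### Sets of vectors with finitely many binary residuals -/

/-- `S` belongs to a family of at most `N` sets that is closed under the residuals
`{x | 2 x + δ ∈ T}` for digit vectors `δ`. -/
def HasResiduals {I : Type*} (N : ℕ) (S : Set (I → ℕ)) : Prop :=
  ∃ (σ : Type) (_ : Fintype σ) (F : σ → Set (I → ℕ)), Fintype.card σ ≤ N ∧ (∃ q, F q = S) ∧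
    ∀ q (δ : I → ℕ), (∀ i, δ i < 2) → ∃ q', ∀ x, (fun i => 2 * x i + δ i) ∈ F q ↔ x ∈ F q'

section Residuals

variable {I J : Type*} {N M : ℕ}

theorem HasResiduals.mono {S : Set (I → ℕ)} (h : HasResiduals N S) (hNM : N ≤ M) :
    HasResiduals M S := by
  obtain ⟨σ, _, F, hc, hS, hF⟩ := h
  exact ⟨σ, _, F, hc.trans hNM, hS, hF⟩

theorem HasResiduals.compl {S : Set (I → ℕ)} (h : HasResiduals N S) : HasResiduals N Sᶜ := by
  obtain ⟨σ, _, F, hc, ⟨q₀, rfl⟩, hF⟩ := h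
  refine ⟨σ, _, fun q => (F q)ᶜ, hc, ⟨q₀, rfl⟩, fun q δ hδ => ?_⟩
  obtain ⟨q', h'⟩ := hF q δ hδ
  exact ⟨q', fun x => not_congr (h' x)⟩

/-- Product automaton. -/
theorem HasResiduals.combine {S T : Set (I → ℕ)} (hS : HasResiduals N S) (hT : HasResiduals M T)
    (op : Prop → Prop → Prop) : HasResiduals (N * M) {x | op (x ∈ S) (x ∈ T)} := by
  obtain ⟨σ, _, F, hc, ⟨q₀, rfl⟩, hF⟩ := hS
  obtain ⟨τ, _, G, hd, ⟨r₀, rfl⟩, hG⟩ := hT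
  refine ⟨σ × τ, inferInstance, fun q => {x | op (x ∈ F q.1) (x ∈ G q.2)}, ?_,
    ⟨(q₀, r₀), rfl⟩, fun q δ hδ => ?_⟩
  · rw [Fintype.card_prod]
    exact Nat.mul_le_mul hc hd
  · obtain ⟨q', h'⟩ := hF q.1 δ hδ
    obtain ⟨r', h''⟩ := hG q.2 δ hδ
    exact ⟨(q', r'), fun x => by simp only [Set.mem_ofPred_eq, h', h'']⟩

theorem HasResiduals.reindex {S : Set (I → ℕ)} (h : HasResiduals N S) (f : I → J) :
    HasResiduals N {x : J → ℕ | x ∘ f ∈ S} := by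
  obtain ⟨σ, _, F, hc, ⟨q₀, rfl⟩, hF⟩ := h
  refine ⟨σ, _, fun q => {x | x ∘ f ∈ F q}, hc, ⟨q₀, rfl⟩, fun q δ hδ => ?_⟩
  obtain ⟨q', h'⟩ := hF q (δ ∘ f) fun i => hδ _
  exact ⟨q', fun x => h' (x ∘ f)⟩

theorem digits_eq (x : I → ℕ) : (fun i => 2 * (x i / 2) + x i % 2) = x := by
  funext i
  omega

theorem sum_elim_digits (x δ : I → ℕ) (y ε : J → ℕ) :
    (Sum.elim (fun i => 2 * x i + δ i) fun j => 2 * y j + ε j) =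
      fun k => 2 * Sum.elim x y k + Sum.elim δ ε k := by
  funext k
  cases k <;> rfl

/-- Subset construction: a residual of the projection is a union of projected residuals, over all
guesses `ε` for the digits of the hidden vector. -/
theorem HasResiduals.proj {S : Set (I ⊕ J → ℕ)} (h : HasResiduals N S) :
    HasResiduals (2 ^ N) {x : I → ℕ | ∃ y, Sum.elim x y ∈ S} := by
  classical
  obtain ⟨σ, _, F, hc, ⟨q₀, rfl⟩, hF⟩ := h
  refine ⟨Set σ, inferInstance, fun Q => {x | ∃ q ∈ Q, ∃ y, Sum.elim x y ∈ F q}, ?_,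
    ⟨{q₀}, by simp⟩, fun Q δ hδ => ?_⟩
  · rw [Fintype.card_set]
    exact Nat.pow_le_pow_right two_pos hc
  · refine ⟨{q' | ∃ q ∈ Q, ∃ ε : J → ℕ, (∀ j, ε j < 2) ∧
      ∀ x, (fun k => 2 * x k + Sum.elim δ ε k) ∈ F q ↔ x ∈ F q'}, fun x => ⟨?_, ?_⟩⟩
    · rintro ⟨q, hq, y, hy⟩
      have hε : ∀ j, y j % 2 < 2 := fun j => Nat.mod_lt _ two_pos
      obtain ⟨q', h'⟩ := hF q (Sum.elim δ fun j => y j % 2) (by rintro (i | j) <;> simp [*])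
      refine ⟨q', ⟨q, hq, _, hε, h'⟩, fun j => y j / 2, (h' _).1 ?_⟩
      rwa [← sum_elim_digits, digits_eq]
    · rintro ⟨q', ⟨q, hq, ε, hε, h'⟩, y, hy⟩
      refine ⟨q, hq, fun j => 2 * y j + ε j, ?_⟩
      rw [sum_elim_digits]
      exact (h' _).2 hy

theorem HasResiduals.forall {S : Set (I ⊕ J → ℕ)} (h : HasResiduals N S) :
    HasResiduals (2 ^ N) {x : I → ℕ | ∀ y, Sum.elim x y ∈ S} := by
  have := h.compl.proj.compl
  convert this using 1
  ext x
  simp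

/-- Let `A t` be the set of states whose sets contain a vector of at most `t` binary digits. The `A
t` increase and each determines the next, so the chain is constant after at most `Fintype.card σ`
steps. -/
theorem exists_lt_two_pow [Finite I] {σ : Type} [Fintype σ] {F : σ → Set (I → ℕ)}
    (hF : ∀ q (δ : I → ℕ), (∀ i, δ i < 2) →
      ∃ q', ∀ x, (fun i => 2 * x i + δ i) ∈ F q ↔ x ∈ F q') {q : σ} (hq : (F q).Nonempty) :
    ∃ x ∈ F q, ∀ i, x i < 2 ^ Fintype.card σ := by
  classical
  set A : ℕ → Finset σ := fun t => Finset.univ.filter fun q => ∃ x ∈ F q, ∀ i, x i < 2 ^ t with hA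
  have memA : ∀ t q, q ∈ A t ↔ ∃ x ∈ F q, ∀ i, x i < 2 ^ t := fun t q => by simp [hA]
  have mono : ∀ t, A t ⊆ A (t + 1) := fun t q hq => by
    rw [memA] at hq ⊢
    obtain ⟨x, hx, hlt⟩ := hq
    exact ⟨x, hx, fun i => (hlt i).trans (Nat.pow_lt_pow_right (by norm_num) (by omega))⟩
  have step : ∀ t q, q ∈ A (t + 1) ↔ ∃ δ : I → ℕ, (∀ i, δ i < 2) ∧ ∃ q' ∈ A t,
      ∀ x, (fun i => 2 * x i + δ i) ∈ F q ↔ x ∈ F q' := fun t q => by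
    rw [memA]
    constructor
    · rintro ⟨x, hx, hlt⟩
      have hδ : ∀ i, x i % 2 < 2 := fun i => Nat.mod_lt _ two_pos
      obtain ⟨q', h'⟩ := hF q _ hδ
      refine ⟨_, hδ, q', (memA _ _).2 ⟨fun i => x i / 2, (h' _).1 ?_, fun i => ?_⟩, h'⟩
      · rwa [digits_eq]
      · have := hlt i
        rw [pow_succ] at this
        change x i / 2 < 2 ^ t
        omega
    · rintro ⟨δ, hδ, q', hq', h'⟩
      obtain ⟨x, hx, hlt⟩ := (memA _ _).1 hq'
      refine ⟨_, (h' x).2 hx, fun i => ?_⟩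
      have := hlt i
      have := hδ i
      rw [pow_succ]
      omega
  have stable : ∀ t, A (t + 1) = A t → ∀ s, A (t + s) = A t := fun t ht s => by
    induction s with
    | zero => rfl
    | succ s ih =>
      rw [← ht]
      ext q
      rw [← add_assoc, step, step, ih]
  -- Until it becomes stationary, the chain gains at least one state per step.
  have grow : ∀ t, t ≤ (A t).card ∨ ∀ s, A (t + s) = A t := fun t => by
    induction t with
    | zero => exact Or.inl (Nat.zero_le _)
    | succ t ih =>
      by_cases h : A (t + 1) = A t
      · right
        intro s
        rw [h, add_assoc, stable t h]
      · rcases ih with ih | ih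
        · left
          have := Finset.card_lt_card ((mono t).ssubset_of_ne (Ne.symm h))
          omega
        · exact absurd (ih 1) h
  obtain ⟨x, hx⟩ := hq
  rw [← memA]
  suffices ∀ t, A t ⊆ A (Fintype.card σ) by
    obtain ⟨t, ht⟩ := (Set.finite_range x).bddAbove
    exact this t ((memA _ _).2 ⟨x, hx, fun i =>
      (ht (Set.mem_range_self i)).trans_lt Nat.lt_two_pow_self⟩)
  intro t
  rcases le_total t (Fintype.card σ) with h | h
  · exact monotone_nat_of_le_succ (f := A) mono h
  · obtain ⟨s, rfl⟩ := Nat.exists_eq_add_of_le h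
    rcases grow (Fintype.card σ) with h' | h'
    · have : A (Fintype.card σ) = Finset.univ :=
        Finset.eq_univ_of_card _ (le_antisymm (Finset.card_le_univ _) h')
      rw [this]
      exact Finset.subset_univ _
    · rw [h']

theorem HasResiduals.exists_lt [Finite I] {S : Set (I → ℕ)} (h : HasResiduals N S)
    (hS : S.Nonempty) : ∃ x ∈ S, ∀ i, x i < 2 ^ N := by
  obtain ⟨σ, _, F, hc, ⟨q₀, rfl⟩, hF⟩ := h
  obtain ⟨x, hx, hlt⟩ := exists_lt_two_pow hF hS
  exact ⟨x, hx, fun i => (hlt i).trans_le (Nat.pow_le_pow_right two_pos hc)⟩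

/-- This bounds an inner quantifier relative to the outer variables: strip `L` digits from `x` and
`y` together. Then `x` is zero, and `N` further digits of `y` suffice. -/
theorem HasResiduals.exists_lt_of_lt [Finite J] {S : Set (I ⊕ J → ℕ)} (h : HasResiduals N S)
    {L : ℕ} {x : I → ℕ} (hx : ∀ i, x i < 2 ^ L) (hS : ∃ y, Sum.elim x y ∈ S) :
    ∃ y, (∀ j, y j < 2 ^ (L + N)) ∧ Sum.elim x y ∈ S := by
  obtain ⟨σ, _, F, hc, ⟨q₀, rfl⟩, hF⟩ := h
  induction L generalizing x q₀ with
  | zero =>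
    obtain rfl : x = 0 := by
      funext i
      simpa using hx i
    -- The slices at `x = 0` are closed under residuals, since all further digits of `x` are zero.
    obtain ⟨y, hy, hlt⟩ := exists_lt_two_pow
      (F := fun q => {y : J → ℕ | Sum.elim (0 : I → ℕ) y ∈ F q})
      (fun q δ hδ => by
        obtain ⟨q', h'⟩ := hF q (Sum.elim (0 : I → ℕ) δ) (by rintro (i | j) <;> simp [*])
        refine ⟨q', fun y => ?_⟩
        rw [Set.mem_ofPred_eq, Set.mem_ofPred_eq, ← h' (Sum.elim (0 : I → ℕ) y), ← sum_elim_digits]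
        rfl) hS
    refine ⟨y, fun j => (hlt j).trans_le (Nat.pow_le_pow_right two_pos ?_), hy⟩
    omega
  | succ L ih =>
    obtain ⟨y, hy⟩ := hS
    have hδ : ∀ i, Sum.elim (fun i => x i % 2) (fun j => y j % 2) i < 2 := by
      rintro (i | j) <;> exact Nat.mod_lt _ two_pos
    obtain ⟨q', h'⟩ := hF q₀ _ hδ
    obtain ⟨y', hlt, hy'⟩ := ih (x := fun i => x i / 2) (fun i => by
      have := hx i
      rw [pow_succ] at this
      omega) q' ⟨fun j => y j / 2, (h' _).1 (by rwa [← sum_elim_digits, digits_eq, digits_eq])⟩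
    refine ⟨fun j => 2 * y' j + y j % 2, fun j => ?_, ?_⟩
    · have := hlt j
      rw [add_right_comm, pow_succ]
      change 2 * y' j + y j % 2 < _
      omega
    · have := (h' _).2 hy'
      rwa [← sum_elim_digits, digits_eq] at this

/-- After the lowest digits are removed, each comparison is again strict or weak, depending on these
digits. A state records which comparisons are weak (`true`). -/
theorem hasResiduals_lt [Fintype I] (f : I → J) (k : J) {n : ℕ} (hn : Fintype.card I ≤ n) :
    HasResiduals (2 ^ n) {x : J → ℕ | ∀ i, x (f i) < x k} := by
  classical
  refine HasResiduals.mono (N := 2 ^ Fintype.card I) ?_ (Nat.pow_le_pow_right two_pos hn)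
  let e := Fintype.equivFin I
  refine ⟨Fin (Fintype.card I) → Bool, inferInstance,
    fun s => {x | ∀ i, if s (e i) then x (f i) ≤ x k else x (f i) < x k}, by simp,
    ⟨fun _ => false, by simp⟩, fun s δ hδ => ⟨fun i => if s i then
      decide (δ (f (e.symm i)) ≤ δ k) else decide (δ (f (e.symm i)) < δ k), fun x => ?_⟩⟩
  refine forall_congr' fun i => ?_
  have h₁ := hδ (f i)
  have h₂ := hδ k
  rcases Bool.eq_false_or_eq_true (s (e i)) with h | h
  · by_cases h' : δ (f i) ≤ δ k
    · simp only [h, if_true, Equiv.symm_apply_apply, h', decide_true]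
      omega
    · simp only [h, if_true, Equiv.symm_apply_apply, h', decide_false, Bool.false_eq_true, if_false]
      omega
  · by_cases h' : δ (f i) < δ k
    · simp only [h, Bool.false_eq_true, if_false, Equiv.symm_apply_apply, h', decide_true, if_true]
      omega
    · simp only [h, Bool.false_eq_true, if_false, Equiv.symm_apply_apply, h', decide_false]
      omega

end Residuals

/-! ### Residuals of semilinear sets -/

theorem mem_closure_list {V : Type*} {ps : List (V → ℕ)} {x : V → ℕ} :
    x ∈ AddSubmonoid.closure {p | p ∈ ps} ↔
      ∃ l : Fin ps.length → ℕ, ∀ v, x v = ∑ j, l j * ps.get j v := by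
  rw [← Set.range_list_get, AddSubmonoid.mem_closure_range_iff]
  constructor
  · rintro ⟨l, rfl⟩
    refine ⟨l, fun v => ?_⟩
    rw [Finsupp.sum_fintype _ _ (by simp)]
    simp [Finset.sum_apply]
  · rintro ⟨l, hl⟩
    refine ⟨Finsupp.equivFunOnFinite.symm l, ?_⟩
    rw [Finsupp.sum_fintype _ _ (by simp)]
    funext v
    simp [Finset.sum_apply, hl]

theorem mem_vadd_closure_list {V : Type*} {ps : List (V → ℕ)} {b x : V → ℕ} :
    x ∈ b +ᵥ (AddSubmonoid.closure {p | p ∈ ps} : Set (V → ℕ)) ↔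
      ∃ l : Fin ps.length → ℕ, ∀ v, x v = b v + ∑ j, l j * ps.get j v := by
  rw [Set.mem_vadd_set]
  constructor
  · rintro ⟨y, hy, rfl⟩
    obtain ⟨l, hl⟩ := mem_closure_list.1 hy
    exact ⟨l, fun v => by simp [hl]⟩
  · rintro ⟨l, hl⟩
    exact ⟨fun v => ∑ j, l j * ps.get j v, mem_closure_list.2 ⟨l, fun _ => rfl⟩,
      funext fun v => (hl v).symm⟩

/-- The linear set with base `b` and periods `ps`. -/
def linearSet {V : Type*} {k : ℕ} (ps : Fin k → V → ℕ) (b : V → ℕ) : Set (V → ℕ) :=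
  {x | ∃ l : Fin k → ℕ, ∀ v, x v = b v + ∑ j, l j * ps j v}

/-- Write the coefficients as `m + 2 l` with `m` the parities. Then `b + ∑ m p` is absorbed into a
new base after removing `δ` and halving. As `b` and the sum of the periods are at most `M`, so is
the new base: only finitely many bases occur. -/
theorem linearSet_residual {V : Type*} {k M : ℕ} {ps : Fin k → V → ℕ} {b δ : V → ℕ}
    (hb : ∀ v, b v ≤ M) (hp : ∀ v, ∑ j, ps j v ≤ M) (hδ : ∀ v, δ v < 2) (x : V → ℕ) :
    (fun v => 2 * x v + δ v) ∈ linearSet ps b ↔ ∃ b' : V → ℕ, (∀ v, b' v ≤ M) ∧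
      (∃ m : Fin k → ℕ, ∀ v, 2 * b' v + δ v = b v + ∑ j, m j * ps j v) ∧
        x ∈ linearSet ps b' := by
  have split : ∀ m l : Fin k → ℕ, ∀ v, ∑ j, (m j + 2 * l j) * ps j v =
      ∑ j, m j * ps j v + 2 * ∑ j, l j * ps j v := fun m l v => by
    rw [Finset.mul_sum, ← Finset.sum_add_distrib]
    exact Finset.sum_congr rfl fun j _ => by ring
  constructor
  · rintro ⟨l, hl⟩
    have bound : ∀ v, ∑ j, (l j % 2) * ps j v ≤ M := fun v => by
      refine (Finset.sum_le_sum fun j _ => ?_).trans (hp v)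
      have : l j % 2 ≤ 1 := by omega
      simpa using Nat.mul_le_mul_right (ps j v) this
    have key : ∀ v, 2 * x v + δ v =
        b v + (∑ j, (l j % 2) * ps j v + 2 * ∑ j, (l j / 2) * ps j v) := fun v => by
      rw [← split]
      simp only [Nat.mod_add_div]
      exact hl v
    refine ⟨fun v => (b v + ∑ j, (l j % 2) * ps j v) / 2, fun v => ?_,
      ⟨fun j => l j % 2, fun v => ?_⟩, fun j => l j / 2, fun v => ?_⟩
    · have := bound v
      have := hb v
      dsimp only
      omega
    · have := key v
      have := hδ v
      dsimp only
      omega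
    · have := key v
      have := hδ v
      dsimp only
      omega
  · rintro ⟨b', -, ⟨m, hm⟩, l, hl⟩
    refine ⟨fun j => m j + 2 * l j, fun v => ?_⟩
    have := hm v
    have := hl v
    rw [split]
    change 2 * x v + δ v = _
    omega

theorem SemilinearRep.mem_toSet {V : Type*} {R : SemilinearRep V} {x : V → ℕ} :
    x ∈ R.toSet ↔ ∃ c ∈ R, x ∈ linearSet c.2.get c.1 := by
  simp only [SemilinearRep.toSet, Set.mem_iUnion, mem_vadd_closure_list, exists_prop, linearSet,
    Set.mem_ofPred_eq]

/-- A state is a set of pairs of a component and a current base in `[0, M]^d`; the periods never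
change. -/
theorem SemilinearRep.hasResiduals {d M : ℕ} (R : SemilinearRep (Fin d))
    (hb : ∀ c ∈ R, ∀ v, c.1 v ≤ M) (hp : ∀ c ∈ R, ∀ v, ∑ j, c.2.get j v ≤ M) :
    HasResiduals (2 ^ (R.length * (M + 1) ^ d)) R.toSet := by
  classical
  refine ⟨Set (Fin R.length × (Fin d → Fin (M + 1))), inferInstance, fun Q =>
    {x | ∃ q ∈ Q, x ∈ linearSet (R.get q.1).2.get fun v => (q.2 v : ℕ)}, ?_,
    ⟨{q | ∀ v, (q.2 v : ℕ) = (R.get q.1).1 v}, ?_⟩, fun Q δ hδ => ?_⟩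
  · simp [Fintype.card_set]
  · ext x
    rw [SemilinearRep.mem_toSet]
    constructor
    · rintro ⟨q, hq, h⟩
      refine ⟨R.get q.1, List.get_mem _ _, ?_⟩
      rwa [← funext hq]
    · rintro ⟨c, hc, h⟩
      obtain ⟨j, rfl⟩ := List.get_of_mem hc
      exact ⟨(j, fun v => ⟨(R.get j).1 v, Nat.lt_succ_of_le (hb _ hc v)⟩), fun _ => rfl, h⟩
  · refine ⟨{q' | ∃ b : Fin d → Fin (M + 1), (q'.1, b) ∈ Q ∧
      ∃ m : Fin (R.get q'.1).2.length → ℕ, ∀ v,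
        2 * (q'.2 v : ℕ) + δ v = b v + ∑ j, m j * (R.get q'.1).2.get j v}, fun x => ⟨?_, ?_⟩⟩
    · rintro ⟨⟨i, b⟩, hq, h⟩
      obtain ⟨b', hb', hm, hx⟩ := (linearSet_residual (fun v => Nat.le_of_lt_succ (b v).2)
        (hp _ (List.get_mem R i)) hδ x).1 h
      exact ⟨(i, fun v => ⟨b' v, Nat.lt_succ_of_le (hb' v)⟩), ⟨b, hq, hm⟩, hx⟩
    · rintro ⟨⟨i, b'⟩, ⟨b, hq, hm⟩, h⟩
      exact ⟨(i, b), hq, (linearSet_residual (fun v => Nat.le_of_lt_succ (b v).2)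
        (hp _ (List.get_mem R i)) hδ x).2
          ⟨fun v => b' v, fun v => Nat.le_of_lt_succ (b' v).2, hm, h⟩⟩

end PCompat

namespace PCompat

open Pointwise

/-! ### The exchange relations -/

section Exchange

variable {V : Type*} [DecidableEq V] {n : ℕ} {P : Fin n → Finset V} {S : Set (V → ℕ)} {U : Finset V}

theorem replaceOn_restrict (x : V → ℕ) : replaceOn U x (fun v => x v) = x := by
  funext v
  simp [replaceOn]

theorem replaceOn_eq_add (γ : V → ℕ) (α : U → ℕ) :
    replaceOn U γ α = replaceOn U γ 0 + replaceOn U 0 α := by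
  funext v
  by_cases hv : v ∈ U <;> simp [replaceOn, hv]

/-- Extension of a vector by zero outside `U`. -/
def extendZero (U : Finset V) : (U → ℕ) →+ (V → ℕ) where
  toFun := replaceOn U 0
  map_zero' := by
    funext v
    simp [replaceOn]
  map_add' α β := by
    funext v
    by_cases hv : v ∈ U <;> simp [replaceOn, hv]

theorem extendZero_of_notMem (α : U → ℕ) {v : V} (hv : v ∉ U) : extendZero U α v = 0 := by
  simp [extendZero, replaceOn, hv]

theorem extendZero_of_mem (α : U → ℕ) {v : V} (hv : v ∈ U) : extendZero U α v = α ⟨v, hv⟩ := by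
  simp [extendZero, replaceOn, hv]

theorem finite_quotient_of_forall {X F : Type*} [Finite F] (s : Setoid X) (f : X → F)
    (h : ∀ x y, f x = f y → s.r x y) : Finite (Quotient s) := by
  refine Finite.of_injective (fun q : Quotient s => f q.out) fun q q' hq => ?_
  rw [← q.out_eq, ← q'.out_eq]
  exact Quotient.sound (h _ _ hq)

/-- Exchange the parts one at a time. Since they are disjoint, an exchange on one part leaves the
others untouched. -/
theorem mem_iff_of_exchange (hP : IsPartition P) {x y : V → ℕ}
    (h : ∀ i, (exchangeSetoid S (P i)).r (fun v => x v) (fun v => y v)) : x ∈ S ↔ y ∈ S := by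
  suffices ∀ (s : Finset (Fin n)) (x : V → ℕ), (∀ v, (∀ i ∈ s, v ∉ P i) → x v = y v) →
      (∀ i ∈ s, (exchangeSetoid S (P i)).r (fun v => x v) (fun v => y v)) → (x ∈ S ↔ y ∈ S) by
    refine this Finset.univ x (fun v hv => ?_) fun i _ => h i
    obtain ⟨i, hi⟩ := hP.2 v
    exact absurd hi (hv i (Finset.mem_univ i))
  intro s
  induction s using Finset.induction_on with
  | empty =>
    intro x hx _
    rw [funext fun v => hx v (by simp)]
  | insert i s hi ih =>
    intro x hx hr
    have h₁ := hr i (Finset.mem_insert_self i s) x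
    rw [replaceOn_restrict] at h₁
    rw [h₁]
    refine ih _ (fun v hv => ?_) fun j hj => ?_
    · by_cases hvi : v ∈ P i
      · simp [replaceOn, hvi]
      · simp only [replaceOn, hvi, dif_neg, not_false_eq_true]
        exact hx v fun j hj => by
          rcases Finset.mem_insert.1 hj with rfl | hj
          exacts [hvi, hv j hj]
    · have hne : j ≠ i := fun h => hi (h ▸ hj)
      convert hr j (Finset.mem_insert_of_mem hj) using 2 with v
      have : (v : V) ∉ P i := Finset.disjoint_left.1 (hP.1 j i hne) v.2
      simp [replaceOn, this]

/-- The defining condition is a first-order formula over `S`, and semilinear sets are exactly the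
Presburger definable ones. The variable `γ` ranges over all of `V`; its coordinates in `U` are
ignored. -/
theorem exchange_isSemilinearSet [Finite V] (hS : IsSemilinearSet S) :
    IsSemilinearSet {x : U ⊕ U → ℕ | (exchangeSetoid S U).r (x ∘ Sum.inl) (x ∘ Sum.inr)} := by
  rw [← FirstOrder.Language.presburger.definable_iff_isSemilinearSet (A := ∅)]
  have hS' := hS.definable (A := ∅)
  have h₁ := hS'.preimage_comp fun v : V =>
    if h : v ∈ U then (Sum.inl (Sum.inl ⟨v, h⟩) : (U ⊕ U) ⊕ V) else Sum.inr v
  have h₂ := hS'.preimage_comp fun v : V =>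
    if h : v ∈ U then (Sum.inl (Sum.inr ⟨v, h⟩) : (U ⊕ U) ⊕ V) else Sum.inr v
  have h := ((h₁.inter h₂).union (h₁.compl.inter h₂.compl)).forall_of_finite
  convert h using 1
  ext x
  refine forall_congr' fun γ => ?_
  have e₁ : replaceOn U γ (x ∘ Sum.inl) = Sum.elim x γ ∘ fun v : V =>
      if h : v ∈ U then (Sum.inl (Sum.inl ⟨v, h⟩) : (U ⊕ U) ⊕ V) else Sum.inr v := by
    funext v
    by_cases hv : v ∈ U <;> simp [replaceOn, hv]
  have e₂ : replaceOn U γ (x ∘ Sum.inr) = Sum.elim x γ ∘ fun v : V =>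
      if h : v ∈ U then (Sum.inl (Sum.inr ⟨v, h⟩) : (U ⊕ U) ⊕ V) else Sum.inr v := by
    funext v
    by_cases hv : v ∈ U <;> simp [replaceOn, hv]
  rw [e₁, e₂]
  simp only [Set.mem_union, Set.mem_inter_iff, Set.mem_compl_iff, Set.mem_preimage]
  tauto

/-- Cut the relation with the translated coordinate subspace where the first vector is `α`, and
project to the second. -/
theorem exchange_class_isSemilinearSet [Finite V] (hS : IsSemilinearSet S) (α : U → ℕ) :
    IsSemilinearSet {β : U → ℕ | (exchangeSetoid S U).r α β} := by
  have h : IsSemilinearSet {x : U ⊕ U → ℕ | x ∘ Sum.inl = α} := by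
    let f : (U → ℕ) →+ (U ⊕ U → ℕ) :=
      { toFun := fun y => Sum.elim 0 y
        map_zero' := by
          funext j
          cases j <;> rfl
        map_add' := fun y z => by
          funext j
          cases j <;> rfl }
    convert ((IsSemilinearSet.univ (M := U → ℕ)).image f).vadd (Sum.elim α 0) using 1
    ext x
    simp only [Set.mem_ofPred_eq, Set.image_univ, Set.mem_vadd_set, Set.mem_range,
      exists_exists_eq_and]
    constructor
    · rintro rfl
      refine ⟨x ∘ Sum.inr, funext ?_⟩
      rintro (j | j) <;> simp [f]
    · rintro ⟨y, rfl⟩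
      funext j
      simp [f]
  convert ((exchange_isSemilinearSet hS).inter h).image (LinearMap.funLeft ℕ ℕ Sum.inr) using 1
  ext β
  simp only [Set.mem_image, Set.mem_inter_iff, Set.mem_ofPred_eq]
  constructor
  · intro hβ
    exact ⟨Sum.elim α β, ⟨hβ, rfl⟩, rfl⟩
  · rintro ⟨x, ⟨hx, rfl⟩, rfl⟩
    exact hx

end Exchange

/-! ### Compatibility and finite index -/

section Compatible

variable {V : Type*} {n : ℕ} {P : Fin n → Finset V} {S T : Set (V → ℕ)}

theorem IsCompatible.empty : IsCompatible P (∅ : Set (V → ℕ)) :=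
  ⟨[], by simp, by simp [SemilinearRep.toSet]⟩

theorem IsCompatible.linear (b : V → ℕ) {ps : List (V → ℕ)}
    (h : ∀ p ∈ ps, ∃ i, ∀ v, v ∉ P i → p v = 0) :
    IsCompatible P (b +ᵥ (AddSubmonoid.closure {p | p ∈ ps} : Set (V → ℕ))) :=
  ⟨[(b, ps)], by simpa using h, by simp [SemilinearRep.toSet]⟩

theorem IsCompatible.union (hS : IsCompatible P S) (hT : IsCompatible P T) :
    IsCompatible P (S ∪ T) := by
  obtain ⟨R, hR, rfl⟩ := hS
  obtain ⟨R', hR', rfl⟩ := hT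
  refine ⟨R ++ R', fun c hc => ?_, ?_⟩
  · rcases List.mem_append.1 hc with hc | hc
    exacts [hR c hc, hR' c hc]
  · simp only [SemilinearRep.toSet, List.mem_append]
    exact Set.biUnion_union {c | c ∈ R} {c | c ∈ R'} _

theorem IsCompatible.biUnion {ι : Type*} {s : Set ι} (hs : s.Finite) {f : ι → Set (V → ℕ)}
    (hf : ∀ i ∈ s, IsCompatible P (f i)) : IsCompatible P (⋃ i ∈ s, f i) := by
  induction s, hs using Set.Finite.induction_on with
  | empty => simpa using IsCompatible.empty
  | insert _ _ ih =>
    rw [Set.biUnion_insert]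
    exact (hf _ (Set.mem_insert _ _)).union (ih fun i hi => hf i (Set.mem_insert_of_mem _ hi))

theorem IsCompatible.add (hS : IsCompatible P S) (hT : IsCompatible P T) :
    IsCompatible P (S + T) := by
  obtain ⟨R, hR, rfl⟩ := hS
  obtain ⟨R', hR', rfl⟩ := hT
  simp only [SemilinearRep.toSet, Set.iUnion_add, Set.add_iUnion]
  refine IsCompatible.biUnion (List.finite_toSet R') fun c' hc' =>
    IsCompatible.biUnion (List.finite_toSet R) fun c hc => ?_
  have : {p | p ∈ c.2 ++ c'.2} = {p | p ∈ c.2} ∪ {p | p ∈ c'.2} := by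
    ext p
    simp
  convert IsCompatible.linear (P := P) (c.1 + c'.1) (ps := c.2 ++ c'.2) fun p hp => ?_ using 1
  · rw [this, AddSubmonoid.closure_union, AddSubmonoid.coe_sup, vadd_add_vadd]
  · rcases List.mem_append.1 hp with hp | hp
    exacts [hR c hc p hp, hR' c' hc' p hp]

theorem IsCompatible.sum {ι : Type*} (s : Finset ι) {f : ι → Set (V → ℕ)}
    (hf : ∀ i ∈ s, IsCompatible P (f i)) : IsCompatible P (∑ i ∈ s, f i) := by
  classical
  induction s using Finset.induction_on with
  | empty =>
    convert IsCompatible.linear (P := P) (0 : V → ℕ) (ps := []) (by simp) using 1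
    simp [Set.singleton_zero]
  | insert i s hi ih =>
    rw [Finset.sum_insert hi]
    exact (hf i (Finset.mem_insert_self i s)).add
      (ih fun j hj => hf j (Finset.mem_insert_of_mem hj))

/-- Any representation works: base plus period lies in `S`, and there is no cancellation in `ℕ`, so
the period vanishes wherever all of `S` does. -/
theorem isCompatible_of_support (hS : IsSemilinearSet S) (i : Fin n)
    (h : ∀ x ∈ S, ∀ v, v ∉ P i → x v = 0) : IsCompatible P S := by
  obtain ⟨R, rfl⟩ := isSemilinearSet_iff_exists_rep.1 hS
  refine ⟨R, fun c hc p hp => ⟨i, fun v hv => ?_⟩, rfl⟩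
  have : c.1 + p ∈ R.toSet := by
    simp only [SemilinearRep.toSet, Set.mem_iUnion]
    exact ⟨c, hc, Set.vadd_mem_vadd_set (AddSubmonoid.subset_closure hp)⟩
  exact (Nat.add_eq_zero_iff.1 (h _ this v hv)).2

variable [DecidableEq V]

theorem isCompatible_of_finite_index [Finite V] (hP : IsPartition P) (hS : IsSemilinearSet S)
    (h : ∀ i, Finite (Quotient (exchangeSetoid S (P i)))) : IsCompatible P S := by
  let cls (x : V → ℕ) (i : Fin n) : Quotient (exchangeSetoid S (P i)) :=
    Quotient.mk _ fun v => x v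
  let box (q : ∀ i, Quotient (exchangeSetoid S (P i))) : Set (V → ℕ) :=
    ∑ i, extendZero (P i) '' {α | (exchangeSetoid S (P i)).r (q i).out α}
  have mem_box : ∀ q x, x ∈ box q ↔ cls x = q := fun q x => by
    simp only [box, Set.mem_fintype_sum]
    constructor
    · rintro ⟨g, hg, rfl⟩
      funext i
      obtain ⟨α, hα, hαg⟩ := hg i
      rw [← (q i).out_eq]
      refine Quotient.sound ((exchangeSetoid S (P i)).symm' ?_)
      suffices (fun v : P i => (∑ j, g j) v) = α by
        rw [this]
        exact hα
      funext v
      rw [Finset.sum_apply, Finset.sum_eq_single i]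
      · rw [← hαg, extendZero_of_mem α v.2]
      · intro j _ hj
        obtain ⟨β, -, hβ⟩ := hg j
        rw [← hβ]
        exact extendZero_of_notMem β (Finset.disjoint_left.1 (hP.1 i j hj.symm) v.2)
      · simp
    · rintro rfl
      refine ⟨fun i => extendZero (P i) fun v => x v,
        fun i => ⟨_, Quotient.mk_out (s := exchangeSetoid S (P i)) _, rfl⟩, ?_⟩
      funext v
      obtain ⟨i, hi⟩ := hP.2 v
      rw [Finset.sum_apply, Finset.sum_eq_single i]
      · rw [extendZero_of_mem _ hi]
      · intro j _ hj
        exact extendZero_of_notMem _ (Finset.disjoint_left.1 (hP.1 i j hj.symm) hi)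
      · simp
  -- A box that meets `S` is contained in it, because its elements agree with each other up to
  -- exchange on every part.
  have : S = ⋃ q ∈ cls '' S, box q := by
    ext x
    simp only [Set.mem_iUnion, mem_box, exists_prop, exists_eq_right', Set.mem_image]
    constructor
    · intro hx
      exact ⟨x, hx, rfl⟩
    · rintro ⟨y, hy, hxy⟩
      exact (mem_iff_of_exchange hP fun i => Quotient.exact (congrFun hxy i)).1 hy
  rw [this]
  refine IsCompatible.biUnion (Set.toFinite _) fun q _ => IsCompatible.sum _ fun i _ =>
    isCompatible_of_support ((exchange_class_isSemilinearSet hS _).image _) i ?_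
  rintro _ ⟨α, -, rfl⟩ v hv
  exact extendZero_of_notMem α hv

/-- The periods fall into those supported on `U` and those vanishing on `U`. The first contribute
nothing off `U`, the second nothing on `U`, so the two restrictions can be solved independently. -/
theorem replaceOn_mem_linear_iff {U : Finset V} {ps : Set (V → ℕ)}
    (h : ∀ p ∈ ps, (∀ v ∉ U, p v = 0) ∨ ∀ v ∈ U, p v = 0) (b γ : V → ℕ) (α : U → ℕ) :
    replaceOn U γ α ∈ b +ᵥ (AddSubmonoid.closure ps : Set (V → ℕ)) ↔
      (∃ y ∈ AddSubmonoid.closure {p ∈ ps | ∀ v ∉ U, p v = 0}, ∀ v : U, α v = b v + y v) ∧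
      ∃ y ∈ AddSubmonoid.closure {p ∈ ps | ∀ v ∈ U, p v = 0}, ∀ v ∉ U, γ v = b v + y v := by
  have hps : ps = {p ∈ ps | ∀ v ∉ U, p v = 0} ∪ {p ∈ ps | ∀ v ∈ U, p v = 0} := by
    ext p
    simp only [Set.mem_union, Set.mem_ofPred_eq, ← and_or_left]
    exact ⟨fun hp => ⟨hp, h p hp⟩, fun hp => hp.1⟩
  have off : ∀ y ∈ AddSubmonoid.closure {p ∈ ps | ∀ v ∉ U, p v = 0}, ∀ v ∉ U, y v = 0 := by
    intro y hy v hv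
    induction hy using AddSubmonoid.closure_induction with
    | mem p hp => exact hp.2 v hv
    | zero => rfl
    | add p q _ _ hp hq => simp [hp, hq]
  have on : ∀ y ∈ AddSubmonoid.closure {p ∈ ps | ∀ v ∈ U, p v = 0}, ∀ v ∈ U, y v = 0 := by
    intro y hy v hv
    induction hy using AddSubmonoid.closure_induction with
    | mem p hp => exact hp.2 v hv
    | zero => rfl
    | add p q _ _ hp hq => simp [hp, hq]
  conv_lhs => rw [hps, AddSubmonoid.closure_union]
  rw [Set.mem_vadd_set]
  constructor
  · rintro ⟨z, hz, hzx⟩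
    obtain ⟨y, hy, y', hy', rfl⟩ := AddSubmonoid.mem_sup.1 hz
    refine ⟨⟨y, hy, fun v => ?_⟩, y', hy', fun v hv => ?_⟩
    · have := congrFun hzx v
      simp [replaceOn, on y' hy' v v.2] at this
      exact this.symm
    · have := congrFun hzx v
      simp [replaceOn, hv, off y hy v hv] at this
      exact this.symm
  · rintro ⟨⟨y, hy, hα⟩, y', hy', hγ⟩
    refine ⟨y + y', AddSubmonoid.mem_sup.2 ⟨y, hy, y', hy', rfl⟩, ?_⟩
    funext v
    by_cases hv : v ∈ U
    · simp [replaceOn, hv, hα, on y' hy' v hv]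
    · simp [replaceOn, hv, hγ, off y hy v hv]

/-- The invariant of `α` is the set of components whose condition on `P i` it satisfies; there are
finitely many such sets. -/
theorem IsCompatible.finite_index (hP : IsPartition P) (hS : IsCompatible P S) (i : Fin n) :
    Finite (Quotient (exchangeSetoid S (P i))) := by
  obtain ⟨R, hR, rfl⟩ := hS
  have good : ∀ c ∈ R, ∀ p ∈ {p | p ∈ c.2}, (∀ v ∉ P i, p v = 0) ∨ ∀ v ∈ P i, p v = 0 := by
    intro c hc p hp
    obtain ⟨j, hj⟩ := hR c hc p hp
    by_cases hij : i = j
    · exact Or.inl (hij ▸ hj)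
    · exact Or.inr fun v hv => hj v (Finset.disjoint_left.1 (hP.1 i j hij) hv)
  refine finite_quotient_of_forall _ (fun α => ({j | ∃ y ∈ AddSubmonoid.closure
    {p ∈ {p | p ∈ (R.get j).2} | ∀ v ∉ P i, p v = 0}, ∀ v : P i, α v = (R.get j).1 v + y v} :
      Set (Fin R.length))) fun α β hαβ γ => ?_
  simp only [SemilinearRep.toSet, Set.mem_iUnion, exists_prop]
  refine exists_congr fun c => and_congr_right fun hc => ?_
  rw [replaceOn_mem_linear_iff (good c hc), replaceOn_mem_linear_iff (good c hc)]
  obtain ⟨j, rfl⟩ := List.get_of_mem hc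
  exact and_congr_left fun _ => Set.ext_iff.1 hαβ j

theorem isCompatible_iff_finite_index [Finite V] (hP : IsPartition P) (hS : IsSemilinearSet S) :
    IsCompatible P S ↔ ∀ i, Finite (Quotient (exchangeSetoid S (P i))) :=
  ⟨fun h => h.finite_index hP, isCompatible_of_finite_index hP hS⟩

theorem finite_index_iff_exists_bound :
    (∀ i, Finite (Quotient (exchangeSetoid S (P i)))) ↔
      ∃ k : ℕ, ∀ i, ∀ α : P i → ℕ, ∃ β : P i → ℕ,
        ∑ v, β v ≤ k ∧ (exchangeSetoid S (P i)).r α β := by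
  constructor
  · intro h
    obtain ⟨k, hk⟩ := (Set.finite_range fun q : Σ i, Quotient (exchangeSetoid S (P i)) =>
      ∑ v, q.2.out v).bddAbove
    refine ⟨k, fun i α => ⟨(Quotient.mk _ α : Quotient (exchangeSetoid S (P i))).out,
      hk ⟨⟨i, _⟩, rfl⟩, (exchangeSetoid S (P i)).symm' (Quotient.mk_out (s := exchangeSetoid S (P i)) α)⟩⟩
  · rintro ⟨k, hk⟩ i
    have : Finite {β : P i → ℕ // ∑ v, β v ≤ k} :=
      ((Set.finite_Iic (fun _ : P i => k)).subset fun β hβ v =>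
        (Finset.single_le_sum (fun _ _ => Nat.zero_le _) (Finset.mem_univ v)).trans hβ).to_subtype
    refine Finite.of_surjective
      (fun β : {β : P i → ℕ // ∑ v, β v ≤ k} =>
        (Quotient.mk _ β.1 : Quotient (exchangeSetoid S (P i)))) fun q => ?_
    obtain ⟨β, hβ, h⟩ := hk i q.out
    exact ⟨⟨β, hβ⟩, by rw [← q.out_eq]; exact Quotient.sound ((exchangeSetoid S (P i)).symm' h)⟩

end Compatible

/-! ### Recognizability -/

/-- The congruence on `ℕ` that identifies numbers from `K` on modulo `p`. -/
def thresholdCon (K p : ℕ) : AddCon ℕ where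
  r a b := a = b ∨ K ≤ a ∧ K ≤ b ∧ a ≡ b [MOD p]
  iseqv := ⟨fun _ => Or.inl rfl, fun h => h.imp Eq.symm fun h => ⟨h.2.1, h.1, h.2.2.symm⟩, by
    rintro a b c (rfl | h) (rfl | h')
    exacts [Or.inl rfl, Or.inr h', Or.inr h, Or.inr ⟨h.1, h'.2.1, h.2.2.trans h'.2.2⟩]⟩
  add' := by
    rintro a b c e (rfl | h) (rfl | h')
    · exact Or.inl rfl
    · exact Or.inr ⟨by omega, by omega, h'.2.2.add_left a⟩
    · exact Or.inr ⟨by omega, by omega, h.2.2.add_right c⟩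
    · exact Or.inr ⟨by omega, by omega, h.2.2.add h'.2.2⟩

theorem finite_thresholdCon_quotient (K : ℕ) {p : ℕ} (hp : 0 < p) :
    Finite (thresholdCon K p).Quotient := by
  refine Finite.of_surjective
    (fun a : Fin (K + p) => ((a : ℕ) : (thresholdCon K p).Quotient)) fun q => ?_
  induction q using AddCon.induction_on with
  | H a =>
    by_cases ha : a < K
    · exact ⟨⟨a, by omega⟩, rfl⟩
    · have := Nat.mod_lt (a - K) hp
      refine ⟨⟨K + (a - K) % p, by omega⟩, (AddCon.eq _).2 (Or.inr ⟨by simp, by omega, ?_⟩)⟩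
      have h : K + (a - K) % p ≡ K + (a - K) [MOD p] := (Nat.mod_modEq _ _).add_left K
      rwa [Nat.add_sub_cancel' (not_lt.1 ha)] at h

theorem periodic_mul {p : ℕ → Prop} {k m : ℕ} (h : ∀ x ≥ k, p x ↔ p (x + m)) (t : ℕ) :
    ∀ x ≥ k, p x ↔ p (x + m * t) := by
  induction t with
  | zero => simp
  | succ t ih =>
    intro x hx
    rw [ih x hx, h (x + m * t) (by omega)]
    ring_nf

section Recognizable

variable {V : Type*} [DecidableEq V] {n : ℕ} {P : Fin n → Finset V} {S : Set (V → ℕ)}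

/-- Vectors on a singleton are numbers, and semilinear sets of numbers are ultimately periodic. With
finitely many classes, the product of their periods and the largest threshold serve all of them. -/
theorem exists_period_of_finite_index [Finite V] {U : Finset V} (hU : U.card = 1)
    (hS : IsSemilinearSet S) (h : Finite (Quotient (exchangeSetoid S U))) :
    ∃ k, ∃ p > 0, ∀ x ≥ k, (exchangeSetoid S U).r (fun _ => x) (fun _ => x + p) := by
  obtain ⟨u, rfl⟩ := Finset.card_eq_one.1 hU
  have key : ∀ q : Quotient (exchangeSetoid S {u}), ∃ k, ∃ p > 0, ∀ x ≥ k,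
      (exchangeSetoid S {u}).r q.out (fun _ => x) ↔
        (exchangeSetoid S {u}).r q.out (fun _ => x + p) := fun q => by
    have h := (exchange_class_isSemilinearSet hS q.out).image
      (LinearMap.proj (R := ℕ) (φ := fun _ : ({u} : Finset V) => ℕ)
        ⟨u, Finset.mem_singleton_self u⟩)
    obtain ⟨k, p, hp, hk⟩ := Nat.isSemilinearSet_iff_ultimately_periodic.1 h
    have mem : ∀ x : ℕ, x ∈ LinearMap.proj (R := ℕ) (φ := fun _ : ({u} : Finset V) => ℕ)
        ⟨u, Finset.mem_singleton_self u⟩ '' {β | (exchangeSetoid S {u}).r q.out β} ↔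
          (exchangeSetoid S {u}).r q.out (fun _ => x) := fun x => by
      constructor
      · rintro ⟨β, hβ, rfl⟩
        suffices (fun _ => β ⟨u, Finset.mem_singleton_self u⟩) = β by
          change (exchangeSetoid S {u}).r q.out fun _ => β ⟨u, Finset.mem_singleton_self u⟩
          rw [this]
          exact hβ
        funext ⟨v, hv⟩
        obtain rfl := Finset.mem_singleton.1 hv
        rfl
      · intro hx
        exact ⟨_, hx, rfl⟩
    refine ⟨k, p, hp, fun x hx => ?_⟩
    rw [← mem, ← mem]
    exact hk x hx
  choose k p hp hk using key
  obtain ⟨K, hK⟩ := (Set.finite_range k).bddAbove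
  have := Fintype.ofFinite (Quotient (exchangeSetoid S {u}))
  refine ⟨K, ∏ q, p q, Finset.prod_pos fun q _ => hp q, fun x hx => ?_⟩
  let q : Quotient (exchangeSetoid S {u}) := Quotient.mk _ fun _ => x
  have hq : (exchangeSetoid S {u}).r q.out fun _ => x :=
    Quotient.mk_out (s := exchangeSetoid S {u}) _
  obtain ⟨t, ht⟩ := Finset.dvd_prod_of_mem p (Finset.mem_univ q)
  rw [ht]
  exact (exchangeSetoid S {u}).trans' ((exchangeSetoid S {u}).symm' hq)
    ((periodic_mul (hk q) t x ((hK ⟨q, rfl⟩).trans hx)).1 hq)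

theorem exists_common_period [Finite V] (hP1 : ∀ i, (P i).card = 1) (hS : IsSemilinearSet S)
    (h : ∀ i, Finite (Quotient (exchangeSetoid S (P i)))) :
    ∃ K, ∃ p > 0, ∀ i a b, thresholdCon K p a b →
      (exchangeSetoid S (P i)).r (fun _ => a) (fun _ => b) := by
  choose k p hp hk using fun i => exists_period_of_finite_index (hP1 i) hS (h i)
  obtain ⟨K, hK⟩ := (Set.finite_range k).bddAbove
  refine ⟨K, ∏ i, p i, Finset.prod_pos fun i _ => hp i, fun i => ?_⟩
  have iter : ∀ t, ∀ x ≥ K, (exchangeSetoid S (P i)).r (fun _ => x) (fun _ => x + p i * t) := by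
    intro t x hx
    induction t with
    | zero => exact (exchangeSetoid S (P i)).refl' _
    | succ t ih =>
      refine (exchangeSetoid S (P i)).trans' ih ?_
      have := hk i (x + p i * t) (((hK ⟨i, rfl⟩).trans hx).trans (Nat.le_add_right _ _))
      rwa [add_assoc, ← Nat.mul_succ] at this
  have le : ∀ a b, K ≤ a → a ≤ b → a ≡ b [MOD ∏ i, p i] →
      (exchangeSetoid S (P i)).r (fun _ => a) (fun _ => b) := by
    intro a b ha hab hmod
    obtain ⟨t, ht⟩ := (Finset.dvd_prod_of_mem p (Finset.mem_univ i)).trans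
      ((Nat.modEq_iff_dvd' hab).1 hmod)
    have := iter t a ha
    rwa [← ht, Nat.add_sub_cancel' hab] at this
  rintro a b (rfl | ⟨ha, hb, hmod⟩)
  · exact (exchangeSetoid S (P i)).refl' _
  · rcases le_total a b with hab | hab
    · exact le a b ha hab hmod
    · exact (exchangeSetoid S (P i)).symm' (le b a hb hab hmod.symm)

theorem isRecognizable_of_finite_index [Finite V] (hP : IsPartition P)
    (hP1 : ∀ i, (P i).card = 1) (hS : IsSemilinearSet S)
    (h : ∀ i, Finite (Quotient (exchangeSetoid S (P i)))) : IsRecognizable S := by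
  obtain ⟨K, p, hp, hr⟩ := exists_common_period hP1 hS h
  have := finite_thresholdCon_quotient K hp
  -- Indexing by `Fin` keeps the finite monoid in `Type`, whatever the universe of `V`.
  let e := Finite.equivFin V
  refine ⟨Fin (Nat.card V) → (thresholdCon K p).Quotient, inferInstance, inferInstance,
    { toFun := fun x j => (x (e.symm j) : (thresholdCon K p).Quotient)
      map_zero' := rfl
      map_add' := fun _ _ => rfl }, Set.Subset.antisymm (Set.subset_preimage_image _ _) ?_⟩
  rintro x ⟨y, hy, hxy⟩
  refine (mem_iff_of_exchange hP fun i => ?_).1 hy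
  obtain ⟨u, hu⟩ := Finset.card_eq_one.1 (hP1 i)
  have huv : ∀ v : P i, (v : V) = u := fun v => Finset.mem_singleton.1 (hu ▸ v.2)
  simp only [huv]
  refine hr i _ _ ((AddCon.eq _).1 ?_)
  have := congrFun hxy (e u)
  change (y (e.symm (e u)) : (thresholdCon K p).Quotient) = x (e.symm (e u)) at this
  rwa [e.symm_apply_apply] at this

/-- Since `γ[U/α] = γ[U/0] + 0[U/α]`, its image under `φ` depends on `α` only through `φ (0[U/α])`.
-/
theorem IsRecognizable.finite_index (h : IsRecognizable S) (U : Finset V) :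
    Finite (Quotient (exchangeSetoid S U)) := by
  obtain ⟨F, _, _, φ, hφ⟩ := h
  refine finite_quotient_of_forall _ (fun α => φ (replaceOn U 0 α)) fun α β hαβ γ => ?_
  rw [hφ, Set.mem_preimage, Set.mem_preimage, replaceOn_eq_add γ α, replaceOn_eq_add γ β, map_add,
    map_add, hαβ]

end Recognizable

end PCompat

namespace PCompat

/-! ### Bounded quantifiers suffice -/

section Bounded

variable {d : ℕ}

/-- The vector that agrees with `α` on `U` and with `γ` elsewhere. -/
def mix (U : Finset (Fin d)) (γ α : Fin d → ℕ) : Fin d → ℕ := fun v => if v ∈ U then α v else γ v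

theorem replaceOn_eq_mix (U : Finset (Fin d)) (γ α : Fin d → ℕ) :
    replaceOn U γ (fun v => α v) = mix U γ α := by
  funext v
  by_cases hv : v ∈ U <;> simp [replaceOn, mix, hv]

/-- Vectors on `U` are replaced by vectors on all of `Fin d`, whose coordinates outside `U` do not
matter. -/
theorem finite_quotient_iff_exists_box (S : Set (Fin d → ℕ)) (U : Finset (Fin d)) :
    Finite (Quotient (exchangeSetoid S U)) ↔ ∃ k : ℕ, ∀ α : Fin d → ℕ, ∃ β : Fin d → ℕ,
      (∀ v, β v < k) ∧ ∀ γ, mix U γ α ∈ S ↔ mix U γ β ∈ S := by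
  constructor
  · intro h
    obtain ⟨k, hk⟩ := (Set.finite_range fun x : Quotient (exchangeSetoid S U) × Fin d =>
      extendZero U x.1.out x.2).bddAbove
    refine ⟨k + 1, fun α => ?_⟩
    let q : Quotient (exchangeSetoid S U) := Quotient.mk _ fun v => α v
    refine ⟨extendZero U q.out, fun v => Nat.lt_succ_of_le (hk ⟨(q, v), rfl⟩), fun γ => ?_⟩
    have := (exchangeSetoid S U).symm' (Quotient.mk_out (s := exchangeSetoid S U) fun v => α v) γ
    rw [replaceOn_eq_mix] at this
    rw [this, ← replaceOn_eq_mix U γ (extendZero U _)]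
    simp only [extendZero_of_mem _ (Subtype.coe_prop _)]
    rfl
  · rintro ⟨k, hk⟩
    have : Finite {β : Fin d → ℕ // ∀ v, β v < k} :=
      ((Set.finite_Iic (fun _ : Fin d => k)).subset fun β hβ v => (hβ v).le).to_subtype
    refine Finite.of_surjective (fun β : {β : Fin d → ℕ // ∀ v, β v < k} =>
      (Quotient.mk _ fun v => β.1 v : Quotient (exchangeSetoid S U))) fun q => ?_
    obtain ⟨β, hβ, h⟩ := hk (extendZero U q.out)
    refine ⟨⟨β, hβ⟩, ?_⟩
    rw [← q.out_eq]
    refine Quotient.sound ((exchangeSetoid S U).symm' fun γ => ?_)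
    have := h γ
    rw [← replaceOn_eq_mix, ← replaceOn_eq_mix] at this
    simp only [extendZero_of_mem _ (Subtype.coe_prop _)] at this
    exact this

/-- The residual counts grow along the formula: `N * N` for the equivalence of two memberships
(`T`), `2 ^ (N * N)` after `∀ γ` (`E`), times `2 ^ n` with `β < k` (`D`), `B₁` after `∃ β` (`G`),
`B₂` after `∀ α` (`H`). So some valid `k` is below `2 ^ B₂`. Counterexamples `α` and `γ` are then
bounded through the complements of `G` and `T`, while `β` is bounded by `k` itself. -/
theorem finite_quotient_iff_bounded {S : Set (Fin d → ℕ)} {N n B₁ B₂ : ℕ} (hS : HasResiduals N S)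
    (hn : d ≤ n) (hB₁ : B₁ = 2 ^ (2 ^ n * 2 ^ (N * N))) (hB₂ : B₂ = 2 ^ B₁)
    (U : Finset (Fin d)) :
    Finite (Quotient (exchangeSetoid S U)) ↔ ∃ k < 2 ^ B₂, ∀ α : Fin d → ℕ,
      (∀ v, α v < 2 ^ (B₂ + B₁)) → ∃ β : Fin d → ℕ, (∀ v, β v < k) ∧
        ∀ γ : Fin d → ℕ, (∀ v, γ v < 2 ^ (B₂ + B₁ + N * N)) →
          (mix U γ α ∈ S ↔ mix U γ β ∈ S) := by
  let f₁ : Fin d → (Fin d ⊕ Fin d) ⊕ Fin d := fun v => if v ∈ U then .inl (.inl v) else .inr v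
  let f₂ : Fin d → (Fin d ⊕ Fin d) ⊕ Fin d := fun v => if v ∈ U then .inl (.inr v) else .inr v
  have e₁ : ∀ α β γ : Fin d → ℕ, Sum.elim (Sum.elim α β) γ ∘ f₁ = mix U γ α := fun α β γ => by
    funext v
    by_cases hv : v ∈ U <;> simp [f₁, mix, hv]
  have e₂ : ∀ α β γ : Fin d → ℕ, Sum.elim (Sum.elim α β) γ ∘ f₂ = mix U γ β := fun α β γ => by
    funext v
    by_cases hv : v ∈ U <;> simp [f₂, mix, hv]
  have hT := (hS.reindex f₁).combine (hS.reindex f₂) Iff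
  set T : Set ((Fin d ⊕ Fin d) ⊕ Fin d → ℕ) :=
    {x | (x ∈ {x | x ∘ f₁ ∈ S}) ↔ (x ∈ {x | x ∘ f₂ ∈ S})} with hTdef
  have memT : ∀ α β γ : Fin d → ℕ, Sum.elim (Sum.elim α β) γ ∈ T ↔
      (mix U γ α ∈ S ↔ mix U γ β ∈ S) := fun α β γ => by
    rw [← e₁ α β γ, ← e₂ α β γ]
    rfl
  have hE := hT.forall
  set E : Set (Fin d ⊕ Fin d → ℕ) := {x | ∀ y, Sum.elim x y ∈ T} with hEdef
  have hD := (hasResiduals_lt (Sum.inr : Fin d → (Unit ⊕ Fin d) ⊕ Fin d) (.inl (.inl ()))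
    (n := n) (by simpa using hn)).combine
      (hE.reindex (Sum.elim (Sum.inl ∘ Sum.inr) Sum.inr :
        Fin d ⊕ Fin d → (Unit ⊕ Fin d) ⊕ Fin d)) And
  set D : Set ((Unit ⊕ Fin d) ⊕ Fin d → ℕ) := {x | _ ∧ _} with hDdef
  have memD : ∀ (κ : Unit → ℕ) (α β : Fin d → ℕ), Sum.elim (Sum.elim κ α) β ∈ D ↔
      (∀ v, β v < κ ()) ∧ ∀ γ, mix U γ α ∈ S ↔ mix U γ β ∈ S := fun κ α β => by
    have : Sum.elim (Sum.elim κ α) β ∘ (Sum.elim (Sum.inl ∘ Sum.inr) Sum.inr :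
        Fin d ⊕ Fin d → (Unit ⊕ Fin d) ⊕ Fin d) = Sum.elim α β := by
      funext j
      cases j <;> rfl
    simp only [hDdef, Set.mem_ofPred_eq, this, hEdef, memT, Sum.elim_inl, Sum.elim_inr]
  have hG := hD.proj
  set G : Set (Unit ⊕ Fin d → ℕ) := {x | ∃ y, Sum.elim x y ∈ D} with hGdef
  have hH := hG.forall
  rw [← hB₁] at hG hH
  rw [← hB₂] at hH
  rw [finite_quotient_iff_exists_box]
  constructor
  · rintro ⟨k, hk⟩
    obtain ⟨κ, hκ, hlt⟩ := hH.exists_lt ⟨fun _ => k, fun α => by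
      obtain ⟨β, hβ⟩ := hk α
      exact ⟨β, (memD _ _ _).2 hβ⟩⟩
    refine ⟨κ (), hlt (), fun α _ => ?_⟩
    obtain ⟨β, hβ⟩ := hκ α
    rw [memD] at hβ
    exact ⟨β, hβ.1, fun γ _ => hβ.2 γ⟩
  · rintro ⟨k, hkB, hk⟩
    refine ⟨k, fun α => ?_⟩
    by_contra hα
    have hα' : Sum.elim (fun _ : Unit => k) α ∈ Gᶜ := fun ⟨β, hβ⟩ => hα ⟨β, (memD _ _ _).1 hβ⟩
    obtain ⟨α, hlt, hα⟩ := hG.compl.exists_lt_of_lt (fun _ => hkB) ⟨α, hα'⟩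
    obtain ⟨β, hβ, h⟩ := hk α hlt
    refine hα ⟨β, (memD _ _ _).2 ⟨hβ, fun γ => ?_⟩⟩
    by_contra hγ
    have hlt' : ∀ j, Sum.elim α β j < 2 ^ (B₂ + B₁) := by
      rintro (j | j)
      · exact hlt j
      · exact (hβ j).trans (hkB.trans_le (Nat.pow_le_pow_right two_pos (Nat.le_add_right _ _)))
    obtain ⟨γ, hγlt, hγ⟩ := hT.compl.exists_lt_of_lt hlt' ⟨γ, fun h => hγ ((memT _ _ _).1 h)⟩
    exact hγ ((memT _ _ _).2 (h γ hγlt))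

end Bounded

/-! ### Primitive recursive evaluation -/

section Primrec

open Encodable

variable {X Y : Type*} [Primcodable X] [Primcodable Y]

theorem primrecPred_forall_lt {f : X → ℕ} {p : X → ℕ → Prop} (hf : Primrec f)
    (hp : PrimrecPred fun x : X × ℕ => p x.1 x.2) : PrimrecPred fun x => ∀ n < f x, p x n := by
  have h : PrimrecRel fun (n : ℕ) (x : X) => p x n := hp.comp (Primrec.pair Primrec.snd Primrec.fst)
  exact (h.forall_mem_list.comp (Primrec.list_range.comp hf) Primrec.id).of_eq (by simp)

theorem primrecPred_exists_lt {f : X → ℕ} {p : X → ℕ → Prop} (hf : Primrec f)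
    (hp : PrimrecPred fun x : X × ℕ => p x.1 x.2) : PrimrecPred fun x => ∃ n < f x, p x n := by
  have h : PrimrecRel fun (n : ℕ) (x : X) => p x n := hp.comp (Primrec.pair Primrec.snd Primrec.fst)
  exact (h.exists_mem_list.comp (Primrec.list_range.comp hf) Primrec.id).of_eq (by simp)

theorem primrecPred_forall_mem {f : X → List Y} {p : X → Y → Prop} (hf : Primrec f)
    (hp : PrimrecPred fun x : X × Y => p x.1 x.2) : PrimrecPred fun x => ∀ y ∈ f x, p x y := by
  have h : PrimrecRel fun (y : Y) (x : X) => p x y := hp.comp (Primrec.pair Primrec.snd Primrec.fst)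
  exact h.forall_mem_list.comp hf Primrec.id

theorem primrecPred_exists_mem {f : X → List Y} {p : X → Y → Prop} (hf : Primrec f)
    (hp : PrimrecPred fun x : X × Y => p x.1 x.2) : PrimrecPred fun x => ∃ y ∈ f x, p x y := by
  have h : PrimrecRel fun (y : Y) (x : X) => p x y := hp.comp (Primrec.pair Primrec.snd Primrec.fst)
  exact h.exists_mem_list.comp hf Primrec.id

theorem primrecPred_iff {p q : X → Prop} (hp : PrimrecPred p) (hq : PrimrecPred q) :
    PrimrecPred fun x => p x ↔ q x :=
  ((hp.and hq).or (hp.not.and hq.not)).of_eq fun x => by tauto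

theorem primrecPred_mem {f : X → ℕ} {g : X → List ℕ} (hf : Primrec f) (hg : Primrec g) :
    PrimrecPred fun x => f x ∈ g x :=
  (primrecPred_exists_mem hg (p := fun x y => y = f x)
    (Primrec.eq.comp Primrec.snd (hf.comp Primrec.fst))).of_eq (by simp)

theorem primrec_pow {f g : X → ℕ} (hf : Primrec f) (hg : Primrec g) :
    Primrec fun x => f x ^ g x :=
  (Primrec₂.unpaired'.1 Nat.Primrec.pow).comp hf hg

theorem primrec_sum {n : X → ℕ} {g : X → ℕ → ℕ} (hn : Primrec n)
    (hg : Primrec fun x : X × ℕ => g x.1 x.2) :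
    Primrec fun x => ∑ j ∈ Finset.range (n x), g x j := by
  refine (Primrec.nat_rec' (h := fun x (p : ℕ × ℕ) => p.2 + g x p.1) hn (Primrec.const 0)
    (Primrec.nat_add.comp (Primrec.snd.comp Primrec.snd)
      (hg.comp (Primrec.pair Primrec.fst (Primrec.fst.comp Primrec.snd))))).of_eq fun x => ?_
  induction n x with
  | zero => rfl
  | succ m ih => rw [Finset.sum_range_succ, ← ih]

/-- The digit of `a` at position `v` in base `C`. -/
def digit (C a v : ℕ) : ℕ := a / C ^ v % C

theorem primrec_digit {C a v : X → ℕ} (hC : Primrec C) (ha : Primrec a) (hv : Primrec v) :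
    Primrec fun x => digit (C x) (a x) (v x) :=
  Primrec.nat_mod.comp (Primrec.nat_div.comp ha (primrec_pow hC hv)) hC

theorem digit_lt {C : ℕ} (hC : 0 < C) (a v : ℕ) : digit C a v < C := Nat.mod_lt _ hC

/-- Bounded vectors are coded by single numbers, which turns vector quantifiers into bounded number
quantifiers. -/
theorem exists_digit_eq {k C : ℕ} (f : Fin k → ℕ) (hf : ∀ v, f v < C) :
    ∃ a < C ^ k, ∀ v, f v = digit C a v := by
  refine ⟨finFunctionFinEquiv fun v => ⟨f v, hf v⟩, Fin.is_lt _, fun v => ?_⟩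
  have := congrArg (fun g => (g v : ℕ))
    (finFunctionFinEquiv.symm_apply_apply fun v : Fin k => (⟨f v, hf v⟩ : Fin C))
  exact this.symm

/-- The coordinate `v` of the vector of a linear component with the coefficients that are coded by
`l` in base `C`. -/
def linearValue (C : ℕ) (c : List ℕ × List (List ℕ)) (l v : ℕ) : ℕ :=
  c.1.getD v 0 + ∑ j ∈ Finset.range c.2.length, digit C l j * (c.2.getD j []).getD v 0

theorem primrec_linearValue {C l v : X → ℕ} {c : X → List ℕ × List (List ℕ)} (hC : Primrec C)
    (hc : Primrec c) (hl : Primrec l) (hv : Primrec v) :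
    Primrec fun x => linearValue (C x) (c x) (l x) (v x) := by
  have hj : Primrec fun x : X × ℕ => x.2 := Primrec.snd
  have h : ∀ {Z : Type _} [Primcodable Z] {f : X → Z}, Primrec f →
      Primrec fun x : X × ℕ => f x.1 := fun hf => hf.comp Primrec.fst
  exact Primrec.nat_add.comp ((Primrec.list_getD 0).comp (Primrec.fst.comp hc) hv)
    (primrec_sum (Primrec.list_length.comp (Primrec.snd.comp hc))
      (Primrec.nat_mul.comp (primrec_digit (h hC) (h hl) hj)
        ((Primrec.list_getD 0).comp ((Primrec.list_getD []).comp (Primrec.snd.comp (h hc)) hj)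
          (h hv))))

/-- Membership of the vector that is coded by `a` in base `A` on `U` and by `c` in base `C`
elsewhere. -/
def MemTest (d : ℕ) (R : List (List ℕ × List (List ℕ))) (U : List ℕ) (A C a c : ℕ) : Prop :=
  ∃ r ∈ R, ∃ l < C ^ r.2.length, ∀ v < d,
    (if v ∈ U then digit A a v else digit C c v) = linearValue C r l v

theorem primrecPred_memTest {d A C a c : X → ℕ} {R : X → List (List ℕ × List (List ℕ))}
    {U : X → List ℕ} (hd : Primrec d) (hR : Primrec R) (hU : Primrec U) (hA : Primrec A)
    (hC : Primrec C) (ha : Primrec a) (hc : Primrec c) :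
    PrimrecPred fun x => MemTest (d x) (R x) (U x) (A x) (C x) (a x) (c x) := by
  refine primrecPred_exists_mem hR (primrecPred_exists_lt
    (primrec_pow (hC.comp Primrec.fst) (Primrec.list_length.comp (Primrec.snd.comp Primrec.snd)))
    (primrecPred_forall_lt (hd.comp (Primrec.fst.comp Primrec.fst)) (Primrec.eq.comp ?_ ?_)))
  · have h : Primrec fun x : ((X × (List ℕ × List (List ℕ))) × ℕ) × ℕ => x.1.1.1 :=
      Primrec.fst.comp (Primrec.fst.comp Primrec.fst)
    exact Primrec.ite (primrecPred_mem Primrec.snd (hU.comp h))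
      (primrec_digit (hA.comp h) (ha.comp h) Primrec.snd)
      (primrec_digit (hC.comp h) (hc.comp h) Primrec.snd)
  · exact primrec_linearValue (hC.comp (Primrec.fst.comp (Primrec.fst.comp Primrec.fst)))
      (Primrec.snd.comp (Primrec.fst.comp Primrec.fst)) (Primrec.snd.comp Primrec.fst) Primrec.snd

/-- A bound for the number of residuals of the semilinear sets of size at most `s`. -/
def residualBound (s : ℕ) : ℕ := 2 ^ (s * (s * s + s + 1) ^ s)

/-- A bound for the number of residuals of the set of all pairs of a number `k` and a vector that
is equivalent to a vector below `k`. -/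
def pairBound (s : ℕ) : ℕ := 2 ^ (2 ^ s * 2 ^ (residualBound s * residualBound s))

/-- The bound for the class representatives. -/
def boxBound (s : ℕ) : ℕ := 2 ^ 2 ^ pairBound s

/-- The bound for the vectors whose classes are tested. -/
def innerBound (s : ℕ) : ℕ := 2 ^ (2 ^ pairBound s + pairBound s)

/-- The bound for the contexts in which vectors are compared. -/
def outerBound (s : ℕ) : ℕ :=
  2 ^ (2 ^ pairBound s + pairBound s + residualBound s * residualBound s)

theorem primrec_two_pow {f : X → ℕ} (hf : Primrec f) : Primrec fun x => 2 ^ f x :=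
  primrec_pow (Primrec.const 2) hf

theorem primrec_residualBound : Primrec residualBound := by
  have h : Primrec fun s : ℕ => s * s + s + 1 :=
    Primrec.succ.comp (Primrec.nat_add.comp (Primrec.nat_mul.comp .id .id) .id)
  exact primrec_two_pow (Primrec.nat_mul.comp .id (primrec_pow h .id))

theorem primrec_pairBound : Primrec pairBound :=
  primrec_two_pow (Primrec.nat_mul.comp (primrec_two_pow .id)
    (primrec_two_pow (Primrec.nat_mul.comp primrec_residualBound primrec_residualBound)))

theorem primrec_boxBound : Primrec boxBound := primrec_two_pow (primrec_two_pow primrec_pairBound)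

theorem primrec_innerBound : Primrec innerBound :=
  primrec_two_pow (Primrec.nat_add.comp (primrec_two_pow primrec_pairBound) primrec_pairBound)

theorem primrec_outerBound : Primrec outerBound :=
  primrec_two_pow (Primrec.nat_add.comp
    (Primrec.nat_add.comp (primrec_two_pow primrec_pairBound) primrec_pairBound)
    (Primrec.nat_mul.comp primrec_residualBound primrec_residualBound))

/-- The test whether the exchange relation on the part `U` has finite index, for inputs of size at
most `s`. -/
def PartTest (d : ℕ) (R : List (List ℕ × List (List ℕ))) (s : ℕ) (U : List ℕ) : Prop :=
  ∃ k < boxBound s, ∀ a < innerBound s ^ d, ∃ b < innerBound s ^ d,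
    (∀ v < d, digit (innerBound s) b v < k) ∧ ∀ c < outerBound s ^ d,
      (MemTest d R U (innerBound s) (outerBound s) a c ↔
        MemTest d R U (innerBound s) (outerBound s) b c)

theorem primrecPred_partTest {d s : X → ℕ} {R : X → List (List ℕ × List (List ℕ))}
    {U : X → List ℕ} (hd : Primrec d) (hR : Primrec R) (hs : Primrec s) (hU : Primrec U) :
    PrimrecPred fun x => PartTest (d x) (R x) (s x) (U x) := by
  have hA := primrec_innerBound.comp hs
  have hC := primrec_outerBound.comp hs
  have h₁ : Primrec fun x : (X × ℕ) × ℕ => x.1.1 := Primrec.fst.comp Primrec.fst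
  have h₂ : Primrec fun x : ((X × ℕ) × ℕ) × ℕ => x.1.1.1 := h₁.comp Primrec.fst
  have h₃ : Primrec fun x : (((X × ℕ) × ℕ) × ℕ) × ℕ => x.1.1.1.1 := h₂.comp Primrec.fst
  refine primrecPred_exists_lt (primrec_boxBound.comp hs) (primrecPred_forall_lt
    (primrec_pow (hA.comp Primrec.fst) (hd.comp Primrec.fst)) (primrecPred_exists_lt
      (primrec_pow (hA.comp h₁) (hd.comp h₁)) (PrimrecPred.and
        (primrecPred_forall_lt (hd.comp h₂) (Primrec.nat_lt.comp
          (primrec_digit (hA.comp h₃) (Primrec.snd.comp Primrec.fst) Primrec.snd)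
          (Primrec.snd.comp (Primrec.fst.comp (Primrec.fst.comp Primrec.fst)))))
        (primrecPred_forall_lt (primrec_pow (hC.comp h₂) (hd.comp h₂)) (primrecPred_iff
          (primrecPred_memTest (hd.comp h₃) (hR.comp h₃) (hU.comp h₃) (hA.comp h₃) (hC.comp h₃)
            (Primrec.snd.comp (Primrec.fst.comp Primrec.fst)) Primrec.snd)
          (primrecPred_memTest (hd.comp h₃) (hR.comp h₃) (hU.comp h₃) (hA.comp h₃) (hC.comp h₃)
            (Primrec.snd.comp Primrec.fst) Primrec.snd))))))

/-- The test for compatibility. -/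
def CompatTest (x : Input) : Prop := ∀ U ∈ x.2.1, PartTest x.1 x.2.2 (encode x) U

theorem primrecPred_compatTest : PrimrecPred CompatTest :=
  primrecPred_forall_mem (Primrec.fst.comp Primrec.snd)
    (primrecPred_partTest (Primrec.fst.comp Primrec.fst)
      (Primrec.snd.comp (Primrec.snd.comp Primrec.fst)) (Primrec.encode.comp Primrec.fst)
      Primrec.snd)

end Primrec

end PCompat

namespace PCompat

/-! ### Correctness of the test -/

section Correctness

open Encodable

variable {d : ℕ}

/-- The presentation of a linear component by lists. -/
def codeComponent (c : (Fin d → ℕ) × List (Fin d → ℕ)) : List ℕ × List (List ℕ) :=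
  (List.ofFn c.1, c.2.map List.ofFn)

/-- The coefficient of a nonzero period is at most some coordinate of `x`; that of a zero period may
be taken to be zero. This bounds the search for coefficients in `MemTest`. -/
theorem exists_coeff_lt {V : Type*} {k C : ℕ} {ps : Fin k → V → ℕ} {b x : V → ℕ} (hC : 0 < C)
    (hx : ∀ v, x v < C) (h : x ∈ linearSet ps b) :
    ∃ l : Fin k → ℕ, (∀ j, l j < C) ∧ ∀ v, x v = b v + ∑ j, l j * ps j v := by
  classical
  obtain ⟨l, hl⟩ := h
  refine ⟨fun j => if ps j = 0 then 0 else l j, fun j => ?_, fun v => ?_⟩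
  · by_cases hj : ps j = 0
    · simpa [hj] using hC
    · obtain ⟨v, hv⟩ := Function.ne_iff.1 hj
      simp only [hj, if_false]
      calc l j ≤ l j * ps j v := Nat.le_mul_of_pos_right _ (Nat.pos_of_ne_zero hv)
        _ ≤ ∑ j, l j * ps j v :=
          Finset.single_le_sum (f := fun j => l j * ps j v) (fun _ _ => Nat.zero_le _)
            (Finset.mem_univ j)
        _ ≤ x v := by rw [hl v]; exact Nat.le_add_left _ _
        _ < C := hx v
  · rw [hl v]
    refine congrArg _ (Finset.sum_congr rfl fun j _ => ?_)
    by_cases hj : ps j = 0 <;> simp [hj]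

/-- All indices are in range, so the default values of `getD` never occur. -/
theorem linearValue_codeComponent (C l : ℕ) (c : (Fin d → ℕ) × List (Fin d → ℕ)) (v : Fin d) :
    linearValue C (codeComponent c) l v =
      c.1 v + ∑ j : Fin c.2.length, digit C l j * c.2.get j v := by
  simp only [linearValue, codeComponent, List.length_map, Finset.sum_range]
  simp [List.getD_eq_getElem?_getD]

theorem mem_sort_map_val {U : Finset (Fin d)} {v : Fin d} :
    (v : ℕ) ∈ (U.sort (· ≤ ·)).map Fin.val ↔ v ∈ U := by
  simp [Fin.val_inj]

theorem memTest_iff (R : SemilinearRep (Fin d)) (U : Finset (Fin d)) {A C : ℕ} (hA : 0 < A)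
    (hAC : A ≤ C) (a c : ℕ) :
    MemTest d (R.map codeComponent) ((U.sort (· ≤ ·)).map Fin.val) A C a c ↔
      mix U (fun v => digit C c v) (fun v => digit A a v) ∈ R.toSet := by
  have hlt : ∀ v, mix U (fun v => digit C c v) (fun v => digit A a v) v < C := fun v => by
    unfold mix
    split
    · exact (digit_lt hA _ _).trans_le hAC
    · exact digit_lt (hA.trans_le hAC) _ _
  have hval : ∀ v : Fin d, (if (v : ℕ) ∈ (U.sort (· ≤ ·)).map Fin.val then digit A a v
      else digit C c v) = mix U (fun v => digit C c v) (fun v => digit A a v) v := fun v => by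
    simp only [mem_sort_map_val, mix]
  rw [SemilinearRep.mem_toSet]
  generalize (U.sort (· ≤ ·)).map Fin.val = L at hval ⊢
  simp only [MemTest, List.mem_map, exists_exists_and_eq_and]
  refine exists_congr fun r => and_congr_right fun _ => ?_
  constructor
  · rintro ⟨l, -, hl⟩
    refine ⟨fun j => digit C l j, fun v => ?_⟩
    rw [← hval, hl v v.2, linearValue_codeComponent]
  · intro h
    obtain ⟨l, hlC, hl⟩ := exists_coeff_lt (hA.trans_le hAC) hlt h
    obtain ⟨m, hm, hlm⟩ := exists_digit_eq l hlC
    refine ⟨m, by simpa [codeComponent] using hm, fun v hv => ?_⟩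
    refine (hval ⟨v, hv⟩).trans ((hl ⟨v, hv⟩).trans ?_)
    refine Eq.trans ?_ (linearValue_codeComponent C m r ⟨v, hv⟩).symm
    simp only [hlm]

theorem partTest_iff (R : SemilinearRep (Fin d)) (U : Finset (Fin d)) {s : ℕ} (hd : d ≤ s)
    (hR : HasResiduals (residualBound s) R.toSet) :
    PartTest d (R.map codeComponent) s ((U.sort (· ≤ ·)).map Fin.val) ↔
      Finite (Quotient (exchangeSetoid R.toSet U)) := by
  have hA : 0 < innerBound s := Nat.pow_pos two_pos
  have hBA : boxBound s ≤ innerBound s := Nat.pow_le_pow_right two_pos (Nat.le_add_right _ _)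
  have hAC : innerBound s ≤ outerBound s := Nat.pow_le_pow_right two_pos (Nat.le_add_right _ _)
  rw [finite_quotient_iff_bounded hR hd rfl rfl U]
  change (∃ k < boxBound s, _) ↔ ∃ k < boxBound s, ∀ α : Fin d → ℕ,
    (∀ v, α v < innerBound s) → ∃ β : Fin d → ℕ, (∀ v, β v < k) ∧
      ∀ γ : Fin d → ℕ, (∀ v, γ v < outerBound s) → _
  refine exists_congr fun k => and_congr_right fun hk => ?_
  simp only [memTest_iff R U hA hAC]
  constructor
  · intro h α hα
    obtain ⟨a, ha, hαa⟩ := exists_digit_eq α hα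
    obtain ⟨b, -, hb, h⟩ := h a ha
    refine ⟨fun v => digit (innerBound s) b v, fun v => hb v v.2, fun γ hγ => ?_⟩
    obtain ⟨c, hc, hγc⟩ := exists_digit_eq γ hγ
    rw [funext hαa, funext hγc]
    exact h c hc
  · intro h a _
    obtain ⟨β, hβ, h⟩ := h _ fun v => digit_lt hA a v
    -- As `k` is below `boxBound s ≤ innerBound s`, the representative `β` can be coded in the same
    -- base as `α`.
    obtain ⟨b, hb, hβb⟩ := exists_digit_eq β fun v => (hβ v).trans (hk.trans_le hBA)
    refine ⟨b, hb, fun v hv => hβb ⟨v, hv⟩ ▸ hβ ⟨v, hv⟩, fun c _ => ?_⟩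
    rw [← funext hβb]
    exact h _ fun v => digit_lt (hA.trans_le hAC) c v

theorem encode_le_of_mem {Y : Type*} [Encodable Y] {y : Y} {l : List Y} (h : y ∈ l) :
    encode y ≤ encode l := by
  induction l with
  | nil => simp at h
  | cons z l ih =>
    rw [encode_list_cons]
    rcases List.mem_cons.1 h with rfl | h
    · exact (Nat.left_le_pair _ _).trans (Nat.le_succ _)
    · exact (ih h).trans ((Nat.right_le_pair _ _).trans (Nat.le_succ _))

theorem length_le_encode {Y : Type*} [Encodable Y] (l : List Y) : l.length ≤ encode l := by
  induction l with
  | nil => simp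
  | cons z l ih =>
    rw [encode_list_cons, List.length_cons]
    exact Nat.succ_le_succ (ih.trans (Nat.right_le_pair _ _))

theorem fst_le_encode {Y Z : Type*} [Encodable Y] [Encodable Z] (x : Y × Z) :
    encode x.1 ≤ encode x := Nat.left_le_pair _ _

theorem snd_le_encode {Y Z : Type*} [Encodable Y] [Encodable Z] (x : Y × Z) :
    encode x.2 ≤ encode x := Nat.right_le_pair _ _

/-- The pairing function dominates both arguments, so the code of the input bounds every length and
entry in it. It can thus serve as the size parameter `s`. -/
theorem hasResiduals_toSet_of_encode_le (R : SemilinearRep (Fin d)) {s : ℕ} (hd : d ≤ s)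
    (hR : encode (R.map codeComponent) ≤ s) : HasResiduals (residualBound s) R.toSet := by
  have hc : ∀ c ∈ R, encode (codeComponent c) ≤ s := fun c hc =>
    (encode_le_of_mem (List.mem_map_of_mem hc)).trans hR
  have hvec : ∀ (x : Fin d → ℕ) v, x v ≤ encode (List.ofFn x) := fun x v =>
    encode_le_of_mem (y := x v) (List.mem_ofFn.2 ⟨v, rfl⟩)
  have hps : ∀ c ∈ R, encode (c.2.map List.ofFn) ≤ s := fun c h =>
    (snd_le_encode (codeComponent c)).trans (hc c h)
  have hlen : R.length ≤ s := by
    have := length_le_encode (R.map codeComponent)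
    rw [List.length_map] at this
    exact this.trans hR
  -- Base entries are at most `s`; the periods, at most `s` many with entries at most `s`, sum to at
  -- most `s * s`.
  refine (R.hasResiduals (M := s * s + s) (fun c h v => ?_) fun c h v => ?_).mono
    (Nat.pow_le_pow_right two_pos (Nat.mul_le_mul hlen (Nat.pow_le_pow_right (by omega) hd)))
  · exact ((hvec c.1 v).trans ((fst_le_encode (codeComponent c)).trans (hc c h))).trans
      (Nat.le_add_left _ _)
  · have hl : c.2.length ≤ s := by
      have := length_le_encode (c.2.map List.ofFn)
      rw [List.length_map] at this
      exact this.trans (hps c h)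
    have hp : ∀ j, c.2.get j v ≤ s := fun j => (hvec _ v).trans
      ((encode_le_of_mem (List.mem_map_of_mem (List.get_mem c.2 j))).trans (hps c h))
    calc ∑ j, c.2.get j v ≤ ∑ _j : Fin c.2.length, s := Finset.sum_le_sum fun j _ => hp j
      _ = c.2.length * s := by simp
      _ ≤ s * s + s := (Nat.mul_le_mul_right s hl).trans (Nat.le_add_right _ _)

theorem compatTest_iff {n : ℕ} {P : Fin n → Finset (Fin d)} (hP : IsPartition P)
    (R : SemilinearRep (Fin d)) : CompatTest (code P R) ↔ IsCompatible P R.toSet := by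
  have hd : d ≤ encode (code P R) := fst_le_encode (code P R)
  have hR : encode (R.map codeComponent) ≤ encode (code P R) :=
    (snd_le_encode (code P R).2).trans (snd_le_encode (code P R))
  rw [isCompatible_iff_finite_index hP (isSemilinearSet_iff_exists_rep.2 ⟨R, rfl⟩)]
  change (∀ U ∈ List.ofFn fun i => ((P i).sort (· ≤ ·)).map Fin.val,
    PartTest d (R.map codeComponent) (encode (code P R)) U) ↔ _
  rw [List.forall_mem_ofFn_iff]
  exact forall_congr' fun i => partTest_iff R (P i) hd (hasResiduals_toSet_of_encode_le R hd hR)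

end Correctness

end PCompat

theorem theorem5p3 :
    -- one algorithm decides compatibility for all finite sets of variables, partitions and
    -- semilinear sets
    (∃ f : PCompat.Input → Bool, Computable f ∧
      ∀ (d n : ℕ) (P : Fin n → Finset (Fin d)) (R : PCompat.SemilinearRep (Fin d)),
        PCompat.IsPartition P →
          (f (PCompat.code P R) = true ↔ PCompat.IsCompatible P R.toSet)) ∧
    (∀ (V : Type*) [Finite V] [DecidableEq V] (n : ℕ) (P : Fin n → Finset V) (S : Set (V → ℕ)),
      PCompat.IsPartition P → IsSemilinearSet S →
        -- compatibility is finiteness of the index of all the equivalence relations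
        (PCompat.IsCompatible P S ↔
          ∀ i, Finite (Quotient (PCompat.exchangeSetoid S (P i)))) ∧
        -- equivalently, vectors of bounded norm represent all classes
        (PCompat.IsCompatible P S ↔
          ∃ k : ℕ, ∀ i, ∀ α : P i → ℕ, ∃ β : P i → ℕ,
            ∑ v, β v ≤ k ∧ (PCompat.exchangeSetoid S (P i)).r α β) ∧
        -- the relations are definable in Presburger arithmetic
        (∀ i, (∅ : Set ℕ).Definable FirstOrder.Language.presburger
          {x : P i ⊕ P i → ℕ |
            (PCompat.exchangeSetoid S (P i)).r (x ∘ Sum.inl) (x ∘ Sum.inr)}) ∧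
        -- for partitions into singletons, compatibility is recognizability
        ((∀ i, (P i).card = 1) →
          (PCompat.IsCompatible P S ↔ PCompat.IsRecognizable S))) := by
  classical
  refine ⟨⟨fun x => decide (PCompat.CompatTest x),
    PCompat.primrecPred_compatTest.decide.to_comp, fun d n P R hP => ?_⟩,
    fun V _ _ n P S hP hS => ?_⟩
  · rw [decide_eq_true_iff, PCompat.compatTest_iff hP]
  · have h := PCompat.isCompatible_iff_finite_index hP hS
    exact ⟨h, h.trans PCompat.finite_index_iff_exists_bound,
      fun i => (PCompat.exchange_isSemilinearSet hS).definable, fun hP1 =>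
        ⟨fun hc => PCompat.isRecognizable_of_finite_index hP hP1 hS (h.1 hc),
          fun hr => h.2 fun i => hr.finite_index (P i)⟩⟩
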